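/- **Definitions.** Let $\mathcal N$ be a directed poset of natural numbers and let $\mathsf S_n\subset\mathsf S_N$ be compatible inclusions of symmetric groups for $n\preceq N$ in $\mathcal N$. A *consistent sequence* $\mathscr V$ over these data consists of finite-dimensional real inner product spaces $\mathbb V_n$ with an orthogonal action of $\mathsf S_n$, and injective $\mathsf S_n$-equivariant linear maps $\varphi_{N,n}\colon\mathbb V_n\to\mathbb V_N$ for $n\preceq N$, with $\varphi_{n,n}=\mathrm{id}$ and $\varphi_{N,M}\varphi_{M,n}=\varphi_{N,n}$. Write $\varphi_{N,n}^\star$ for the adjoint of $\varphi_{N,n}$, and $\mathrm{sym}_{\mathsf S_N}=\frac1{N!}\sum_{g\in\mathsf S_N}g$. The two basic sequences have $\mathbb V_n=\mathbb R^n$ with the standard inner product and $\mathsf S_n$ permuting coordinates: - $\mathscr Z$ is indexed by $\mathbb N=\{0,1,2,\dots\}$ with the order $\le$. Its embeddings are zero-padding $x\mapsto(x,0_{N-n})$, and $g\in\mathsf S_n$ is identified with $\mathrm{blkdiag}(g,I_{N-n})\in\mathsf S_N$. - $\mathscr D$ is indexed by the positive integers ordered by divisibility. Its embeddings are duplication $x\mapsto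 x\otimes\mathbf 1_{N/n}$, and $g\in\mathsf S_n$ is identified with $g\otimes I_{N/n}\in\mathsf S_N$. Let $\mathcal F$ be a construction built from the identity by finitely many Cartesian products, tensor products and symmetric powers $\mathrm{Sym}^k$ with $k\ge0$. Here $\mathrm{Sym}^kW\subset W^{\otimes k}$ is the space of symmetric tensors with the Frobenius inner product, and actions and embeddings are extended in the natural way. Its degree is defined by $\deg\mathrm{id}=1$, $\deg(\mathcal F_1\times\mathcal F_2)=\max(\deg\mathcal F_1,\deg\mathcal F_2)$, $\deg(\mathcal F_1\otimes\mathcal F_2)=\deg\mathcal F_1+\deg\mathcal F_2$ and $\deg\mathrm{Sym}^k\mathcal F=k\deg\mathcal F$. A $\mathscr Z$-sequence (respectively $\mathscr D$-sequence) of degree $d$ is a sequence $\mathcal F(\mathscr Z)$ (respectively $\mathcal F(\mathscr D)$) with $\deg\mathcal F=d$. The space $\mathbb V_n$ is obtained by applying $\mathcal F$ to $\mathbb R^n$; this also defines $\mathbb V_0$ for a $\mathscr D$-sequence, which is needed only if $d=0$. The space of freely-described elements is $$\varprojlim\mathbb V_n^{\mathsf S_n}=\Big\{(v_n)\in\prod_{n\in\mathcal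 N}\mathbb V_n^{\mathsf S_n}:\ \varphi_{N,n}^\star v_N=v_n\text{ for all }n\preceq N\Big\}.$$ The space of freely-symmetrized elements is the direct limit $$\varinjlim\mathbb V_n^{\mathsf S_n}=\bigsqcup_{n\in\mathcal N}\mathbb V_n^{\mathsf S_n}\big/\sim,$$ where $\sim$ is generated by $v_n\sim\mathrm{sym}_{\mathsf S_N}\varphi_{N,n}v_n$ for $n\preceq N$. Let $\pi_n\colon\varprojlim\mathbb V_m^{\mathsf S_m}\to\mathbb V_n^{\mathsf S_n}$ be the map $(v_m)\mapsto v_n$, and let $\varsigma_n\colon\mathbb V_n^{\mathsf S_n}\to\varinjlim\mathbb V_m^{\mathsf S_m}$ be the map sending $v_n$ to its class. **Proposition.** Let $\mathscr V$ be a $\mathscr Z$-sequence or a $\mathscr D$-sequence of degree $d$. Then $$\dim\varprojlim\mathbb V_n^{\mathsf S_n}=\dim\varinjlim\mathbb V_n^{\mathsf S_n}=\dim\mathbb V_d^{\mathsf S_d}.$$ Moreover, there is an index $k$ such that $\pi_n$ and $\varsigma_n$ are isomorphisms for all $n\succeq k$, and such that the maps $\mathrm{sym}_{\mathsf S_N}\varphi_{N,n}\colon\mathbb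 V_n^{\mathsf S_n}\to\mathbb V_N^{\mathsf S_N}$ and $\varphi_{N,n}^\star\colon\mathbb V_N^{\mathsf S_N}\to\mathbb V_n^{\mathsf S_n}$ are isomorphisms whenever $N\succeq n\succeq k$. -/

import Mathlib

open scoped TensorProduct

noncomputable section

/-! ### Nested symmetric groups indexed by a directed poset -/

/-- A directed poset of indices `n`, each with its symmetric group `S_n` (on `size n` letters),
and compatible inclusions `S_n ⊂ S_N` of groups for `n ≤ N`. -/
structure NestedSymmetricGroups where
  Index : Type
  [order : PartialOrder Index]
  [directed : IsDirectedOrder Index]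
  [nonempty : Nonempty Index]
  size : Index → ℕ
  size_injective : Function.Injective size
  incl : ∀ {n N : Index}, n ≤ N →
    (Equiv.Perm (Fin (size n)) →* Equiv.Perm (Fin (size N)))
  incl_injective : ∀ {n N : Index} (h : n ≤ N), Function.Injective (incl h)
  incl_refl : ∀ n : Index, incl (le_refl n) = MonoidHom.id _
  incl_trans : ∀ {n M N : Index} (h : n ≤ M) (h' : M ≤ N),
    (incl h').comp (incl h) = incl (h.trans h')

attribute [instance] NestedSymmetricGroups.order NestedSymmetricGroups.directed
  NestedSymmetricGroups.nonempty

/-! ### Consistent sequences -/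

/-- A consistent sequence over a chain `C` of nested symmetric groups: finite-dimensional inner
product spaces `V n` with an orthogonal action of `S_n`, and injective equivariant linear maps
`V n → V N` for `n ≤ N`. The spaces are recorded for all natural numbers `n`, also
for those that are not the size of an index of `C`; maps exist only between indices of `C`. -/
structure ConsistentSequence (C : NestedSymmetricGroups) where
  V : ℕ → Type
  [normedAddCommGroup : ∀ n, NormedAddCommGroup (V n)]
  [innerProductSpace : ∀ n, InnerProductSpace ℝ (V n)]
  [finiteDimensional : ∀ n, FiniteDimensional ℝ (V n)]
  act : ∀ n, Representation ℝ (Equiv.Perm (Fin n)) (V n)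
  inner_act : ∀ (n : ℕ) (g : Equiv.Perm (Fin n)) (x y : V n),
    inner ℝ (act n g x) (act n g y) = inner ℝ x y
  emb : ∀ {n N : C.Index}, n ≤ N → (V (C.size n) →ₗ[ℝ] V (C.size N))
  emb_injective : ∀ {n N : C.Index} (h : n ≤ N), Function.Injective (emb h)
  emb_act : ∀ {n N : C.Index} (h : n ≤ N) (g : Equiv.Perm (Fin (C.size n))) (x : V (C.size n)),
    emb h (act _ g x) = act _ (C.incl h g) (emb h x)
  emb_refl : ∀ n : C.Index, emb (le_refl n) = LinearMap.id
  emb_trans : ∀ {n M N : C.Index} (h : n ≤ M) (h' : M ≤ N),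
    (emb h').comp (emb h) = emb (h.trans h')

attribute [instance] ConsistentSequence.normedAddCommGroup ConsistentSequence.innerProductSpace
  ConsistentSequence.finiteDimensional

/-! ### The two basic sequences -/

/-- The action `(σ x)_i = x_{σ⁻¹ i}` of `S_n` on `ℝⁿ`. -/
def permAct (n : ℕ) : Representation ℝ (Equiv.Perm (Fin n)) (EuclideanSpace ℝ (Fin n)) where
  toFun σ :=
    { toFun := fun x => WithLp.toLp 2 fun i => x (σ⁻¹ i)
      map_add' := fun _ _ => rfl
      map_smul' := fun _ _ => rfl }
  map_one' := rfl
  map_mul' _ _ := rfl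

theorem permAct_apply (n : ℕ) (σ : Equiv.Perm (Fin n)) (x : EuclideanSpace ℝ (Fin n)) (i : Fin n) :
    permAct n σ x i = x (σ⁻¹ i) := rfl

theorem permAct_inner (n : ℕ) (σ : Equiv.Perm (Fin n)) (x y : EuclideanSpace ℝ (Fin n)) :
    inner ℝ (permAct n σ x) (permAct n σ y) = inner ℝ x y := by
  simp only [PiLp.inner_apply, permAct_apply]
  exact Equiv.sum_comp σ⁻¹ fun i => inner ℝ (x i) (y i)

/-- `g ↦ blkdiag(g, I_{N-n})`. -/
def blockIncl {n N : ℕ} (h : n ≤ N) : Equiv.Perm (Fin n) →* Equiv.Perm (Fin N) :=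
  Equiv.Perm.viaEmbeddingHom (Fin.castLEEmb h)

theorem blockIncl_of_lt {n N : ℕ} (h : n ≤ N) (g : Equiv.Perm (Fin n)) (i : Fin N)
    (hi : i.1 < n) : blockIncl h g i = Fin.castLE h (g ⟨i, hi⟩) :=
  Equiv.Perm.viaEmbedding_apply g (Fin.castLEEmb h) ⟨i, hi⟩

theorem blockIncl_of_ge {n N : ℕ} (h : n ≤ N) (g : Equiv.Perm (Fin n)) (i : Fin N)
    (hi : ¬ i.1 < n) : blockIncl h g i = i := by
  refine Equiv.Perm.viaEmbedding_apply_of_notMem g (Fin.castLEEmb h) i ?_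
  rintro ⟨j, rfl⟩
  exact hi j.2

/-- The chain of symmetric groups of the zero-padding sequence, indexed by `(ℕ, ≤)`. -/
def zeroPaddingGroups : NestedSymmetricGroups where
  Index := ℕ
  size n := n
  size_injective _ _ h := h
  incl h := blockIncl h
  incl_injective h := Equiv.Perm.viaEmbeddingHom_injective _
  incl_refl n := by
    ext g i
    simp [blockIncl_of_lt (le_refl n) g i i.2]
  incl_trans {n M N} h h' := by
    ext g i
    simp only [MonoidHom.comp_apply]
    by_cases hM : i.1 < M
    · rw [blockIncl_of_lt h' _ i hM]
      by_cases hn : i.1 < n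
      · rw [blockIncl_of_lt h _ ⟨i, hM⟩ hn, blockIncl_of_lt (h.trans h') _ i hn]
        rfl
      · rw [blockIncl_of_ge h _ ⟨i, hM⟩ hn, blockIncl_of_ge (h.trans h') _ i hn]
        rfl
    · rw [blockIncl_of_ge h' _ i hM, blockIncl_of_ge (h.trans h') _ i fun hn => hM (hn.trans_le h)]

/-- Zero-padding `x ↦ (x, 0_{N-n})`. -/
def zeroPad (n N : ℕ) : EuclideanSpace ℝ (Fin n) →ₗ[ℝ] EuclideanSpace ℝ (Fin N) where
  toFun x := WithLp.toLp 2 fun i => if h : i.1 < n then x ⟨i, h⟩ else 0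
  map_add' x y := by
    ext i
    by_cases h : i.1 < n <;> simp [h]
  map_smul' c x := by
    ext i
    by_cases h : i.1 < n <;> simp [h]

theorem zeroPad_apply (n N : ℕ) (x : EuclideanSpace ℝ (Fin n)) (i : Fin N) :
    zeroPad n N x i = if h : i.1 < n then x ⟨i, h⟩ else 0 := rfl

theorem zeroPad_injective {n N : ℕ} (h : n ≤ N) : Function.Injective (zeroPad n N) := by
  intro x y hxy
  ext i
  have := congrArg (fun z : EuclideanSpace ℝ (Fin N) => z (Fin.castLE h i)) hxy
  simpa [zeroPad_apply] using this

theorem zeroPad_permAct {n N : ℕ} (h : n ≤ N) (g : Equiv.Perm (Fin n))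
    (x : EuclideanSpace ℝ (Fin n)) :
    zeroPad n N (permAct n g x) = permAct N (blockIncl h g) (zeroPad n N x) := by
  ext i
  rw [permAct_apply, zeroPad_apply, zeroPad_apply, ← map_inv]
  by_cases hi : i.1 < n
  · rw [blockIncl_of_lt h _ i hi]
    simp [hi, permAct_apply]
  · rw [blockIncl_of_ge h _ i hi]
    simp [hi]

theorem zeroPad_self (n : ℕ) : zeroPad n n = LinearMap.id := by
  ext x i
  simp [zeroPad_apply]

theorem zeroPad_comp {n M N : ℕ} (h : n ≤ M) :
    zeroPad M N ∘ₗ zeroPad n M = zeroPad n N := by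
  ext x i
  simp only [LinearMap.comp_apply, zeroPad_apply]
  by_cases hn : i.1 < n
  · simp [hn, hn.trans_le h]
  · simp [hn]

/-- The zero-padding sequence `𝒵`: `ℝⁿ` with the standard inner product, `S_n` permuting
coordinates, and zero-padding embeddings. -/
def zeroPaddingSequence : ConsistentSequence zeroPaddingGroups where
  V n := EuclideanSpace ℝ (Fin n)
  act := permAct
  inner_act := permAct_inner
  emb {n N} _ := zeroPad n N
  emb_injective h := zeroPad_injective h
  emb_act h g x := zeroPad_permAct h g x
  emb_refl n := zeroPad_self n
  emb_trans h _ := zeroPad_comp h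

/-- The positive integers, ordered by divisibility. -/
structure DivIndex where
  val : ℕ
  pos : 0 < val

instance : PartialOrder DivIndex where
  le n N := n.val ∣ N.val
  le_refl n := dvd_refl n.val
  le_trans _ _ _ h h' := dvd_trans h h'
  le_antisymm := by
    rintro ⟨n, _⟩ ⟨N, _⟩ h h'
    obtain rfl : n = N := Nat.dvd_antisymm h h'
    rfl

instance : IsDirectedOrder DivIndex where
  directed m n := ⟨⟨m.val * n.val, Nat.mul_pos m.pos n.pos⟩, Dvd.intro _ rfl, Dvd.intro_left _ rfl⟩

instance : Nonempty DivIndex := ⟨⟨1, one_pos⟩⟩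

/-- The standard equipartition `{0, …, N-1} → {0, …, n-1}` into consecutive blocks of
length `N / n`. -/
def blockOf {n N : ℕ} (hN : 0 < N) (h : n ∣ N) (i : Fin N) : Fin n :=
  ⟨i.1 / (N / n), by
    rw [Nat.div_lt_iff_lt_mul (Nat.div_pos (Nat.le_of_dvd hN h) (Nat.pos_of_dvd_of_pos h hN)),
      Nat.mul_div_cancel' h]
    exact i.2⟩

/-- Positions `{0, …, N-1}` as pairs (block, position inside the block). -/
def blockEquiv {n N : ℕ} (h : n ∣ N) : Fin N ≃ Fin n × Fin (N / n) :=
  (finCongr (Nat.mul_div_cancel' h).symm).trans finProdFinEquiv.symm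

/-- `g ↦ g ⊗ I_{N/n}`, permuting blocks of length `N / n`. -/
def kronIncl {n N : ℕ} (h : n ∣ N) : Equiv.Perm (Fin n) →* Equiv.Perm (Fin N) where
  toFun g := (blockEquiv h).trans ((Equiv.prodCongr g (Equiv.refl _)).trans (blockEquiv h).symm)
  map_one' := by
    ext i
    simp
  map_mul' g g' := by
    ext i
    simp [Prod.map]

theorem kronIncl_val {n N : ℕ} (hN : 0 < N) (h : n ∣ N) (g : Equiv.Perm (Fin n)) (i : Fin N) :
    (kronIncl h g i).1 = i.1 % (N / n) + N / n * (g (blockOf hN h i)).1 := rfl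

theorem blockOf_kronIncl {n N : ℕ} (hN : 0 < N) (h : n ∣ N) (g : Equiv.Perm (Fin n)) (i : Fin N) :
    blockOf hN h (kronIncl h g i) = g (blockOf hN h i) := by
  have hk : 0 < N / n := Nat.div_pos (Nat.le_of_dvd hN h) (Nat.pos_of_dvd_of_pos h hN)
  apply Fin.ext
  change (kronIncl h g i).1 / (N / n) = _
  rw [kronIncl_val hN h, Nat.add_mul_div_left _ _ hk, Nat.div_eq_of_lt (Nat.mod_lt _ hk), zero_add]

theorem div_eq_mul_div {n M N : ℕ} (hN : 0 < N) (h : n ∣ M) (h' : M ∣ N) :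
    N / n = (N / M) * (M / n) := by
  obtain ⟨a, rfl⟩ := h
  obtain ⟨b, rfl⟩ := h'
  have h1 : 0 < n * a := Nat.pos_of_mul_pos_right hN
  have h2 : 0 < n := Nat.pos_of_mul_pos_right h1
  rw [Nat.mul_div_cancel_left _ h1, Nat.mul_div_cancel_left _ h2, mul_assoc,
    Nat.mul_div_cancel_left _ h2, mul_comm]

theorem blockOf_blockOf {n M N : ℕ} (hM : 0 < M) (hN : 0 < N) (h : n ∣ M) (h' : M ∣ N)
    (i : Fin N) : blockOf hM h (blockOf hN h' i) = blockOf hN (h.trans h') i := by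
  apply Fin.ext
  change i.1 / (N / M) / (M / n) = i.1 / (N / n)
  rw [Nat.div_div_eq_div_mul, div_eq_mul_div hN h h']

theorem blockOf_self {n : ℕ} (hn : 0 < n) (i : Fin n) : blockOf hn (dvd_refl n) i = i := by
  apply Fin.ext
  change i.1 / (n / n) = i.1
  rw [Nat.div_self hn, Nat.div_one]

theorem exists_blockOf_eq {n N : ℕ} (hN : 0 < N) (h : n ∣ N) (j : Fin n) :
    ∃ i : Fin N, blockOf hN h i = j := by
  have hk : 0 < N / n := Nat.div_pos (Nat.le_of_dvd hN h) (Nat.pos_of_dvd_of_pos h hN)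
  refine ⟨(blockEquiv h).symm (j, ⟨0, hk⟩), ?_⟩
  apply Fin.ext
  change (0 + N / n * j.1) / (N / n) = j.1
  rw [zero_add, Nat.mul_div_cancel_left _ hk]

/-- The chain of symmetric groups of the duplication sequence, indexed by the positive integers
ordered by divisibility. -/
def duplicationGroups : NestedSymmetricGroups where
  Index := DivIndex
  size n := n.val
  size_injective := by
    rintro ⟨n, _⟩ ⟨N, _⟩ h
    cases h
    rfl
  incl h := kronIncl h
  incl_injective {n N} h g g' hg := by
    ext j
    obtain ⟨i, rfl⟩ := exists_blockOf_eq N.pos h j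
    rw [← blockOf_kronIncl N.pos h g i, ← blockOf_kronIncl N.pos h g' i]
    exact congrArg (fun e : Equiv.Perm (Fin N.val) => (blockOf N.pos h (e i)).1) hg
  incl_refl n := by
    ext g i
    change (kronIncl (dvd_refl n.val) g i).1 = (g i).1
    rw [kronIncl_val n.pos, blockOf_self, Nat.div_self n.pos, Nat.mod_one, zero_add, one_mul]
  incl_trans {n M N} h h' := by
    ext g i
    change (kronIncl h' (kronIncl h g) i).1 = (kronIncl (dvd_trans h h') g i).1
    rw [kronIncl_val N.pos, kronIncl_val M.pos, kronIncl_val N.pos,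
      blockOf_blockOf M.pos N.pos h h', div_eq_mul_div N.pos h h', Nat.mod_mul]
    change i.1 % (N.val / M.val) + N.val / M.val * (i.1 / (N.val / M.val) % (M.val / n.val) + _) = _
    ring

/-- Duplication `x ↦ x ⊗ 𝟙_{N/n} = (x₁, …, x₁, …, xₙ, …, xₙ)`. -/
def duplicate {n N : ℕ} (hN : 0 < N) (h : n ∣ N) :
    EuclideanSpace ℝ (Fin n) →ₗ[ℝ] EuclideanSpace ℝ (Fin N) where
  toFun x := WithLp.toLp 2 fun i => x (blockOf hN h i)
  map_add' _ _ := rfl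
  map_smul' _ _ := rfl

theorem duplicate_apply {n N : ℕ} (hN : 0 < N) (h : n ∣ N) (x : EuclideanSpace ℝ (Fin n))
    (i : Fin N) : duplicate hN h x i = x (blockOf hN h i) := rfl

theorem duplicate_injective {n N : ℕ} (hN : 0 < N) (h : n ∣ N) :
    Function.Injective (duplicate hN h) := by
  intro x y hxy
  ext j
  obtain ⟨i, rfl⟩ := exists_blockOf_eq hN h j
  exact congrArg (fun z : EuclideanSpace ℝ (Fin N) => z i) hxy

theorem duplicate_permAct {n N : ℕ} (hN : 0 < N) (h : n ∣ N) (g : Equiv.Perm (Fin n))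
    (x : EuclideanSpace ℝ (Fin n)) :
    duplicate hN h (permAct n g x) = permAct N (kronIncl h g) (duplicate hN h x) := by
  ext i
  rw [permAct_apply, duplicate_apply, duplicate_apply, permAct_apply, ← map_inv,
    blockOf_kronIncl]

theorem duplicate_self {n : ℕ} (hn : 0 < n) : duplicate hn (dvd_refl n) = LinearMap.id := by
  ext x i
  rw [duplicate_apply, blockOf_self]
  rfl

theorem duplicate_comp {n M N : ℕ} (hM : 0 < M) (hN : 0 < N) (h : n ∣ M) (h' : M ∣ N) :
    duplicate hN h' ∘ₗ duplicate hM h = duplicate hN (h.trans h') := by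
  ext x i
  rw [LinearMap.comp_apply, duplicate_apply, duplicate_apply, duplicate_apply, blockOf_blockOf]

/-- The duplication sequence `𝒟`: `ℝⁿ` with the standard inner product, `S_n` permuting
coordinates, and duplication embeddings. -/
def duplicationSequence : ConsistentSequence duplicationGroups where
  V n := EuclideanSpace ℝ (Fin n)
  act := permAct
  inner_act := permAct_inner
  emb {_ N} h := duplicate (DivIndex.pos N) h
  emb_injective {_ N} h := duplicate_injective (DivIndex.pos N) h
  emb_act {_ N} h g x := duplicate_permAct (DivIndex.pos N) h g x
  emb_refl n := duplicate_self (DivIndex.pos n)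
  emb_trans {_ M N} h h' := duplicate_comp (DivIndex.pos M) (DivIndex.pos N) h h'

/-! ### Symmetric tensors -/

/-- The bilinear form `⟨v₁ ⊗ ⋯ ⊗ v_k, w₁ ⊗ ⋯ ⊗ w_k⟩ = ∏ ⟨v_i, w_i⟩` on `W^{⊗k}`. -/
def tensorForm (k : ℕ) (W : Type) [NormedAddCommGroup W] [InnerProductSpace ℝ W] :
    (⨂[ℝ] _ : Fin k, W) →ₗ[ℝ] (⨂[ℝ] _ : Fin k, W) →ₗ[ℝ] ℝ :=
  PiTensorProduct.dualDistrib.comp (PiTensorProduct.map fun _ => innerₗ W)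

theorem tensorForm_tprod (k : ℕ) (W : Type) [NormedAddCommGroup W] [InnerProductSpace ℝ W]
    (v w : Fin k → W) :
    tensorForm k W (PiTensorProduct.tprod ℝ v) (PiTensorProduct.tprod ℝ w) =
      ∏ i, inner ℝ (v i) (w i) := by
  simp [tensorForm]

theorem tensorForm_self (k : ℕ) (W : Type) [NormedAddCommGroup W] [InnerProductSpace ℝ W]
    {ι : Type} [Fintype ι] (b : OrthonormalBasis ι ℝ W) (t : ⨂[ℝ] _ : Fin k, W) :
    tensorForm k W t t =
      ∑ p, ((Basis.piTensorProduct fun _ : Fin k => b.toBasis).repr t p) ^ 2 := by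
  classical
  set B := Basis.piTensorProduct fun _ : Fin k => b.toBasis with hB
  have key : ∀ p q, tensorForm k W (B p) (B q) = if p = q then 1 else 0 := by
    intro p q
    rw [hB, Basis.piTensorProduct_apply, Basis.piTensorProduct_apply, tensorForm_tprod]
    simp [OrthonormalBasis.inner_eq_ite, Fintype.prod_ite_zero, ← funext_iff]
  conv_lhs => rw [← B.sum_repr t]
  simp only [map_sum, map_smul, LinearMap.sum_apply, LinearMap.smul_apply, key, smul_eq_mul]
  simp [sq]

theorem tensorForm_comm (k : ℕ) (W : Type) [NormedAddCommGroup W] [InnerProductSpace ℝ W]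
    (s t : ⨂[ℝ] _ : Fin k, W) : tensorForm k W s t = tensorForm k W t s := by
  induction s using PiTensorProduct.induction_on with
  | add x y hx hy => simp [hx, hy]
  | smul_tprod r v =>
    induction t using PiTensorProduct.induction_on with
    | add x y hx hy => simp only [map_add, hx, hy, LinearMap.add_apply]
    | smul_tprod r' w =>
      simp only [map_smul, LinearMap.smul_apply, tensorForm_tprod, smul_eq_mul,
        real_inner_comm]
      ring

theorem tensorForm_map (k : ℕ) (W : Type) [NormedAddCommGroup W] [InnerProductSpace ℝ W]
    (f : W →ₗ[ℝ] W) (hf : ∀ x y, inner ℝ (f x) (f y) = inner ℝ x y) (s t : ⨂[ℝ] _ : Fin k, W) :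
    tensorForm k W (PiTensorProduct.map (fun _ => f) s) (PiTensorProduct.map (fun _ => f) t) =
      tensorForm k W s t := by
  induction s using PiTensorProduct.induction_on with
  | add x y hx hy => simp only [map_add, LinearMap.add_apply, hx, hy]
  | smul_tprod r v =>
    induction t using PiTensorProduct.induction_on with
    | add x y hx hy => simp only [map_add, hx, hy]
    | smul_tprod r' w =>
      simp only [map_smul, LinearMap.smul_apply, PiTensorProduct.map_tprod, tensorForm_tprod, hf]

/-- The subspace of `W^{⊗k}` of tensors fixed by all permutations of the `k` factors. -/
def symmetricTensors (k : ℕ) (W : Type) [AddCommGroup W] [Module ℝ W] :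
    Submodule ℝ (⨂[ℝ] _ : Fin k, W) where
  carrier := {t | ∀ σ : Equiv.Perm (Fin k), PiTensorProduct.reindex ℝ (fun _ => W) σ t = t}
  add_mem' hs ht σ := by rw [map_add, hs σ, ht σ]
  zero_mem' σ := map_zero _
  smul_mem' c t ht σ := by rw [map_smul, ht σ]

/-- `Sym^k W`, the space of symmetric tensors of order `k` over `W`. -/
def SymTensor (k : ℕ) (W : Type) [AddCommGroup W] [Module ℝ W] : Type :=
  ↥(symmetricTensors k W)

namespace SymTensor

section

variable (k : ℕ) (W : Type) [AddCommGroup W] [Module ℝ W]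

instance instAddCommGroup : AddCommGroup (SymTensor k W) :=
  inferInstanceAs (AddCommGroup ↥(symmetricTensors k W))

instance instModule : Module ℝ (SymTensor k W) :=
  inferInstanceAs (Module ℝ ↥(symmetricTensors k W))

/-- The inclusion `Sym^k W ⊂ W^{⊗k}`. -/
def toTensor : SymTensor k W →ₗ[ℝ] ⨂[ℝ] _ : Fin k, W := (symmetricTensors k W).subtype

theorem toTensor_injective : Function.Injective (toTensor k W) := Subtype.val_injective

end

/-- The restriction of `f^{⊗k}` to symmetric tensors. -/
def map (k : ℕ) {W W' : Type} [AddCommGroup W] [Module ℝ W] [AddCommGroup W'] [Module ℝ W']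
    (f : W →ₗ[ℝ] W') : SymTensor k W →ₗ[ℝ] SymTensor k W' :=
  LinearMap.restrict (p := symmetricTensors k W) (q := symmetricTensors k W')
    (PiTensorProduct.map fun _ => f) fun t ht σ => by
      have h := PiTensorProduct.map_reindex (R := ℝ) (fun _ : Fin k => f) σ t
      rw [ht σ] at h
      exact h.symm

theorem toTensor_map (k : ℕ) {W W' : Type} [AddCommGroup W] [Module ℝ W] [AddCommGroup W']
    [Module ℝ W'] (f : W →ₗ[ℝ] W') (t : SymTensor k W) :
    toTensor k W' (map k f t) = PiTensorProduct.map (fun _ => f) (toTensor k W t) := rfl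

theorem map_id (k : ℕ) (W : Type) [AddCommGroup W] [Module ℝ W] :
    map k (LinearMap.id : W →ₗ[ℝ] W) = LinearMap.id := by
  refine LinearMap.ext fun t => toTensor_injective k W ?_
  rw [toTensor_map, PiTensorProduct.map_id]
  rfl

theorem map_comp (k : ℕ) {W W' W'' : Type} [AddCommGroup W] [Module ℝ W] [AddCommGroup W']
    [Module ℝ W'] [AddCommGroup W''] [Module ℝ W''] (g : W' →ₗ[ℝ] W'') (f : W →ₗ[ℝ] W') :
    map k (g ∘ₗ f) = map k g ∘ₗ map k f := by
  refine LinearMap.ext fun t => toTensor_injective k W'' ?_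
  rw [toTensor_map, PiTensorProduct.map_comp]
  rfl

theorem map_injective (k : ℕ) {W W' : Type} [AddCommGroup W] [Module ℝ W] [AddCommGroup W']
    [Module ℝ W'] {f : W →ₗ[ℝ] W'} (hf : Function.Injective f) :
    Function.Injective (map k f) := by
  obtain ⟨g, hg⟩ := f.exists_leftInverse_of_injective (LinearMap.ker_eq_bot.2 hf)
  refine Function.LeftInverse.injective (g := map k g) fun t => ?_
  rw [← LinearMap.comp_apply, ← map_comp, hg, map_id]
  rfl

section

variable (k : ℕ) (W : Type) [NormedAddCommGroup W] [InnerProductSpace ℝ W]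
  [FiniteDimensional ℝ W]

/-- The Frobenius inner product of `W^{⊗k}`, restricted to symmetric tensors. -/
@[reducible]
def core : InnerProductSpace.Core ℝ (SymTensor k W) where
  inner s t := tensorForm k W (toTensor k W s) (toTensor k W t)
  conj_inner_symm s t := tensorForm_comm k W _ _
  re_inner_nonneg t := by
    change 0 ≤ tensorForm k W (toTensor k W t) (toTensor k W t)
    rw [tensorForm_self k W (stdOrthonormalBasis ℝ W)]
    positivity
  add_left s s' t := by simp
  smul_left s t r := by simp
  definite t ht := by
    rw [tensorForm_self k W (stdOrthonormalBasis ℝ W),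
      Finset.sum_eq_zero_iff_of_nonneg fun _ _ => sq_nonneg _] at ht
    refine toTensor_injective k W ?_
    rw [map_zero]
    refine (Basis.piTensorProduct fun _ : Fin k =>
      (stdOrthonormalBasis ℝ W).toBasis).ext_elem fun p => ?_
    simpa using ht p (Finset.mem_univ p)

instance instNormedAddCommGroup : NormedAddCommGroup (SymTensor k W) :=
  (core k W).toNormedAddCommGroup

instance instInnerProductSpace : InnerProductSpace ℝ (SymTensor k W) :=
  InnerProductSpace.ofCore (core k W).toCore

theorem inner_def (s t : SymTensor k W) :
    inner ℝ s t = tensorForm k W (toTensor k W s) (toTensor k W t) := rfl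

instance instFiniteDimensional : FiniteDimensional ℝ (SymTensor k W) :=
  inferInstanceAs (FiniteDimensional ℝ ↥(symmetricTensors k W))

end

end SymTensor

/-! ### Operations on consistent sequences -/

/-- The map `f × g` between products with the `ℓ²` inner product. -/
def prodMapL2 {E F E' F' : Type} [AddCommGroup E] [Module ℝ E] [AddCommGroup F] [Module ℝ F]
    [AddCommGroup E'] [Module ℝ E'] [AddCommGroup F'] [Module ℝ F']
    (f : E →ₗ[ℝ] E') (g : F →ₗ[ℝ] F') : WithLp 2 (E × F) →ₗ[ℝ] WithLp 2 (E' × F') :=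
  (WithLp.linearEquiv 2 ℝ (E' × F')).symm.toLinearMap ∘ₗ (f.prodMap g) ∘ₗ
    (WithLp.linearEquiv 2 ℝ (E × F)).toLinearMap

namespace ConsistentSequence

variable {C : NestedSymmetricGroups}

/-- The Cartesian product of two consistent sequences. -/
def prod (W U : ConsistentSequence C) : ConsistentSequence C where
  V n := WithLp 2 (W.V n × U.V n)
  act n :=
    { toFun := fun g => prodMapL2 (W.act n g) (U.act n g)
      map_one' := by
        rw [map_one, map_one]
        rfl
      map_mul' := fun g g' => by
        rw [map_mul, map_mul]
        rfl }
  inner_act n g x y := by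
    rw [WithLp.prod_inner_apply, WithLp.prod_inner_apply]
    exact congrArg₂ (· + ·) (W.inner_act n g x.fst y.fst) (U.inner_act n g x.snd y.snd)
  emb h := prodMapL2 (W.emb h) (U.emb h)
  emb_injective h x y hxy := by
    have h1 : W.emb h x.fst = W.emb h y.fst := congrArg WithLp.fst hxy
    have h2 : U.emb h x.snd = U.emb h y.snd := congrArg WithLp.snd hxy
    exact WithLp.ofLp_injective 2 (Prod.ext (W.emb_injective h h1) (U.emb_injective h h2))
  emb_act h g x := WithLp.ofLp_injective 2
    (Prod.ext (W.emb_act h g x.fst) (U.emb_act h g x.snd))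
  emb_refl n := by
    rw [W.emb_refl, U.emb_refl]
    rfl
  emb_trans h h' := by
    rw [← W.emb_trans h h', ← U.emb_trans h h']
    rfl

/-- The tensor product of two consistent sequences. -/
def tensor (W U : ConsistentSequence C) : ConsistentSequence C where
  V n := W.V n ⊗[ℝ] U.V n
  act n := (W.act n).tprod (U.act n)
  inner_act n g x y := TensorProduct.inner_map_map
    ((W.act n g).isometryOfInner (W.inner_act n g)) ((U.act n g).isometryOfInner (U.inner_act n g))
    x y
  emb h := TensorProduct.map (W.emb h) (U.emb h)
  emb_injective h := by
    obtain ⟨f, hf⟩ := (W.emb h).exists_leftInverse_of_injective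
      (LinearMap.ker_eq_bot.2 (W.emb_injective h))
    obtain ⟨g, hg⟩ := (U.emb h).exists_leftInverse_of_injective
      (LinearMap.ker_eq_bot.2 (U.emb_injective h))
    refine Function.LeftInverse.injective (g := TensorProduct.map f g) fun t => ?_
    rw [← LinearMap.comp_apply, ← TensorProduct.map_comp, hf, hg, TensorProduct.map_id]
    rfl
  emb_act h g x := by
    have e : ∀ (A : ConsistentSequence C), A.emb h ∘ₗ A.act _ g = A.act _ (C.incl h g) ∘ₗ A.emb h :=
      fun A => LinearMap.ext (A.emb_act h g)
    rw [Representation.tprod_apply, Representation.tprod_apply, ← LinearMap.comp_apply,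
      ← LinearMap.comp_apply, ← TensorProduct.map_comp, ← TensorProduct.map_comp, e W, e U]
  emb_refl n := by rw [W.emb_refl, U.emb_refl, TensorProduct.map_id]
  emb_trans h h' := by
    rw [← W.emb_trans h h', ← U.emb_trans h h', TensorProduct.map_comp]

/-- The sequence `Sym^k W` of symmetric tensors of order `k`, that is, of homogeneous polynomials
of degree `k`. -/
def sym (k : ℕ) (W : ConsistentSequence C) : ConsistentSequence C where
  V n := SymTensor k (W.V n)
  act n :=
    { toFun := fun g => SymTensor.map k (W.act n g)
      map_one' := by
        rw [map_one]
        exact SymTensor.map_id k _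
      map_mul' := fun g g' => by
        rw [map_mul]
        exact SymTensor.map_comp k _ _ }
  inner_act n g x y := tensorForm_map k (W.V n) (W.act n g) (W.inner_act n g) _ _
  emb h := SymTensor.map k (W.emb h)
  emb_injective h := SymTensor.map_injective k (W.emb_injective h)
  emb_act h g x := by
    change (SymTensor.map k (W.emb h) ∘ₗ SymTensor.map k (W.act _ g)) x =
      (SymTensor.map k (W.act _ (C.incl h g)) ∘ₗ SymTensor.map k (W.emb h)) x
    rw [← SymTensor.map_comp, ← SymTensor.map_comp]
    exact congrArg (fun f => SymTensor.map k f x) (LinearMap.ext (W.emb_act h g))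
  emb_refl n := by rw [W.emb_refl, SymTensor.map_id]
  emb_trans h h' := by rw [← W.emb_trans h h', SymTensor.map_comp]

end ConsistentSequence

/-- A formal sequence of operations that can be applied to a consistent sequence. Powers `W^d`,
tensor powers and sums of several `Sym^j W` are iterated instances. -/
inductive Construction
  | id : Construction
  | prod : Construction → Construction → Construction
  | tensor : Construction → Construction → Construction
  | sym : ℕ → Construction → Construction

namespace Construction

/-- The degree of a construction. -/
def degree : Construction → ℕ
  | id => 1
  | prod F G => max F.degree G.degree
  | tensor F G => F.degree + G.degree
  | sym k F => k * F.degree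

/-- The result of applying a construction to a consistent sequence. -/
def apply {C : NestedSymmetricGroups} (B : ConsistentSequence C) :
    Construction → ConsistentSequence C
  | id => B
  | prod F G => (F.apply B).prod (G.apply B)
  | tensor F G => (F.apply B).tensor (G.apply B)
  | sym k F => (F.apply B).sym k

end Construction

namespace ConsistentSequence

variable {C : NestedSymmetricGroups}

/-- `V` is a `B`-sequence of degree `d`: it is obtained from `B` by a construction of
degree `d`. -/
def HasDegreeOver (V B : ConsistentSequence C) (d : ℕ) : Prop :=
  ∃ F : Construction, F.degree = d ∧ V = F.apply B

/-! ### Invariants and free elements -/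

/-- The invariants `V_n^{S_n}`. -/
abbrev invariants (V : ConsistentSequence C) (n : ℕ) : Submodule ℝ (V.V n) :=
  (V.act n).invariants

/-- The Reynolds operator `sym_{S_n} = (1 / n!) ∑_g g`. -/
def reynolds (V : ConsistentSequence C) (n : ℕ) : V.V n →ₗ[ℝ] V.V n :=
  (Fintype.card (Equiv.Perm (Fin n)) : ℝ)⁻¹ • ∑ g : Equiv.Perm (Fin n), V.act n g

theorem reynolds_apply (V : ConsistentSequence C) (n : ℕ) (x : V.V n) :
    V.reynolds n x =
      (Fintype.card (Equiv.Perm (Fin n)) : ℝ)⁻¹ • ∑ g : Equiv.Perm (Fin n), V.act n g x := by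
  simp [reynolds]

theorem reynolds_mem (V : ConsistentSequence C) (n : ℕ) (x : V.V n) :
    V.reynolds n x ∈ V.invariants n := by
  intro g
  rw [reynolds_apply, map_smul, map_sum]
  congr 1
  simp only [← Module.End.mul_apply, ← map_mul]
  exact Equiv.sum_comp (Equiv.mulLeft g) fun g' => V.act n g' x

theorem reynolds_act (V : ConsistentSequence C) (n : ℕ) (g : Equiv.Perm (Fin n)) (x : V.V n) :
    V.reynolds n (V.act n g x) = V.reynolds n x := by
  rw [reynolds_apply, reynolds_apply]
  congr 1
  simp only [← Module.End.mul_apply, ← map_mul]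
  exact Equiv.sum_comp (Equiv.mulRight g) fun g' => V.act n g' x

theorem reynolds_of_mem (V : ConsistentSequence C) (n : ℕ) {x : V.V n}
    (hx : x ∈ V.invariants n) : V.reynolds n x = x := by
  have h : ∀ g, V.act n g x = x := hx
  rw [reynolds_apply]
  simp only [h, Finset.sum_const, Finset.card_univ]
  rw [← Nat.cast_smul_eq_nsmul ℝ, smul_smul, inv_mul_cancel₀, one_smul]
  exact Nat.cast_ne_zero.2 Fintype.card_ne_zero

/-- The symmetrized embedding `sym_{S_N} φ_{N,n} : V_n^{S_n} → V_N^{S_N}`. -/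
def symEmb (V : ConsistentSequence C) {n N : C.Index} (h : n ≤ N) :
    V.invariants (C.size n) →ₗ[ℝ] V.invariants (C.size N) :=
  LinearMap.codRestrict (V.invariants (C.size N))
    (V.reynolds (C.size N) ∘ₗ V.emb h ∘ₗ (V.invariants (C.size n)).subtype)
    fun _ => V.reynolds_mem _ _

theorem coe_symEmb (V : ConsistentSequence C) {n N : C.Index} (h : n ≤ N)
    (v : V.invariants (C.size n)) :
    (V.symEmb h v : V.V (C.size N)) = V.reynolds _ (V.emb h v) := rfl

theorem adjoint_emb_mem (V : ConsistentSequence C) {n N : C.Index} (h : n ≤ N)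
    {w : V.V (C.size N)} (hw : w ∈ V.invariants (C.size N)) :
    LinearMap.adjoint (V.emb h) w ∈ V.invariants (C.size n) := by
  have hw' : ∀ g, V.act _ g w = w := hw
  intro g
  refine ext_inner_right ℝ fun x => ?_
  have e : V.act _ g (V.act _ g⁻¹ x) = x := by
    rw [← Module.End.mul_apply, ← map_mul, mul_inv_cancel, map_one]
    rfl
  calc inner ℝ (V.act _ g (LinearMap.adjoint (V.emb h) w)) x
      = inner ℝ (LinearMap.adjoint (V.emb h) w) (V.act _ g⁻¹ x) := by
        conv_lhs => rw [← e]
        rw [V.inner_act]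
    _ = inner ℝ (V.act _ (C.incl h g⁻¹) w) (V.act _ (C.incl h g⁻¹) (V.emb h x)) := by
        rw [LinearMap.adjoint_inner_left, V.emb_act, hw']
    _ = inner ℝ (LinearMap.adjoint (V.emb h) w) x := by
        rw [V.inner_act, LinearMap.adjoint_inner_left]

/-- The projection `φ_{N,n}^* : V_N^{S_N} → V_n^{S_n}`. -/
def proj (V : ConsistentSequence C) {n N : C.Index} (h : n ≤ N) :
    V.invariants (C.size N) →ₗ[ℝ] V.invariants (C.size n) :=
  LinearMap.restrict (LinearMap.adjoint (V.emb h)) fun _ hw => V.adjoint_emb_mem h hw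

theorem coe_proj (V : ConsistentSequence C) {n N : C.Index} (h : n ≤ N)
    (w : V.invariants (C.size N)) :
    (V.proj h w : V.V (C.size n)) = LinearMap.adjoint (V.emb h) (w : V.V (C.size N)) := rfl

/-- The space of freely-described elements: families `(v_n)` of invariants with
`φ_{N,n}^* v_N = v_n` for all `n ≤ N`. -/
def freelyDescribed (V : ConsistentSequence C) :
    Submodule ℝ (∀ n : C.Index, V.invariants (C.size n)) where
  carrier := {v | ∀ (n N : C.Index) (h : n ≤ N), V.proj h (v N) = v n}
  add_mem' hv hw n N h := by
    simp only [Pi.add_apply, map_add]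
    rw [hv n N h, hw n N h]
  zero_mem' n N h := by simp
  smul_mem' c v hv n N h := by
    simp only [Pi.smul_apply, map_smul]
    rw [hv n N h]

/-- The symmetrized embeddings form a directed system. -/
instance directedSystem_symEmb (V : ConsistentSequence C) :
    DirectedSystem (fun n : C.Index => V.invariants (C.size n))
      (fun _ _ h => V.symEmb h) where
  map_self n v := by
    apply Subtype.ext
    rw [coe_symEmb, V.emb_refl]
    exact V.reynolds_of_mem _ v.2
  map_map N M n h h' v := by
    apply Subtype.ext
    rw [coe_symEmb, coe_symEmb, coe_symEmb, V.reynolds_apply (C.size M), map_smul, map_sum, map_smul,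
      map_sum, ← V.emb_trans h h', LinearMap.comp_apply]
    simp only [V.emb_act, V.reynolds_act, Finset.sum_const, Finset.card_univ]
    rw [← Nat.cast_smul_eq_nsmul ℝ, smul_smul, inv_mul_cancel₀, one_smul]
    exact Nat.cast_ne_zero.2 Fintype.card_ne_zero

/-- The space of freely-symmetrized elements: the disjoint union of the `V_n^{S_n}`, modulo the
identification of `v_n` with `sym_{S_N} φ_{N,n} v_n` for `n ≤ N`. -/
abbrev FreelySymmetrized (V : ConsistentSequence C) : Type :=
  DirectLimit (fun n : C.Index => V.invariants (C.size n)) (fun _ _ h => V.symEmb h)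

/-- The map `π_n` sending a freely-described element `(v_m)` to `v_n`. -/
def piMap (V : ConsistentSequence C) (n : C.Index) :
    V.freelyDescribed →ₗ[ℝ] V.invariants (C.size n) :=
  LinearMap.proj n ∘ₗ V.freelyDescribed.subtype

/-- The map `ς_n` sending an invariant `v_n` to the class `(sym_N φ_{N,n} v_n)_{N ≥ n}`. -/
def sigmaMap (V : ConsistentSequence C) (n : C.Index) :
    V.invariants (C.size n) →ₗ[ℝ] V.FreelySymmetrized :=
  DirectLimit.Module.of ℝ C.Index (fun n : C.Index => V.invariants (C.size n))
    (fun _ _ h => V.symEmb h) n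

end ConsistentSequence

/-! ### The choice between the two basic sequences -/

/-- The two basic sequences: zero-padding and duplication. -/
inductive BasicSequence
  | zeroPadding : BasicSequence
  | duplication : BasicSequence

/-- The groups underlying a basic sequence. -/
def BasicSequence.groups : BasicSequence → NestedSymmetricGroups
  | zeroPadding => zeroPaddingGroups
  | duplication => duplicationGroups

/-- The basic sequence `𝒵` or `𝒟`. -/
def BasicSequence.sequence : (b : BasicSequence) → ConsistentSequence b.groups
  | zeroPadding => zeroPaddingSequence
  | duplication => duplicationSequence

end

/-!
A construction `F` of degree `d` acts not only on the spaces of the basic sequence `B` but on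
arbitrary linear maps between them (`Construction.map`), functorially and compatibly with adjoints.
In the standard bases, permutations and the adjoints of the embeddings `φ_{N,n}` are all given by
partial maps between index sets, so `F` turns partial maps `a` into linear maps `push F a`. The
partial identity of a set `S` of coordinates yields a notion of vectors *supported in* `S`, and `F`
having degree `d` means that `F(B)_n` is spanned by vectors supported in at most `d` coordinates
(`span_supportedIn_eq_top`). Two facts follow.

* If `a` hits every index, then `push F a` followed by averaging is onto the invariants
  (`exists_reynolds_push_eq`). Indeed let `v` have support `S`, lift it along a section of `a`,
  average over `S_N` and push forward by `a`. A term of the result is a permuted copy of `v` when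
  the partial map in question is defined and injective on `S`, and otherwise its support is smaller
  than `S`; one concludes by induction on the size of `S`. Consequently all projections `φ_{N,n}^*`
  are onto on invariants, and `dim V_n^{S_n}` increases with `n`.
* If `d ≤ n ≤ N`, then a vector of `F(B)_N` supported in at most `d` coordinates can be permuted
  into the first `n` coordinates. So the invariants of `F(B)_N` are averages of zero-padded
  invariants of `F(B)_n` (`symMap_push_castLE_surjective`), and the dimension is constant from `d`
  on. This compares spaces only, and hence applies to the duplication sequence too.

From an index of size at least `d` on, the projections are therefore bijective on invariants, and so
are their adjoints, the symmetrized embeddings. The limits of such systems are computed by any one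
of their terms (`bijective_of_proj_surjective_of_finrank_eq`).
-/

/-! ### Symmetrization of tensors -/

section Symmetrization

variable (k : ℕ) (W : Type) [AddCommGroup W] [Module ℝ W]

/-- The projection `W^{⊗k} → Sym^k W`, averaging over the permutations of the `k` factors. -/
noncomputable def SymTensor.symmetrize : (⨂[ℝ] _ : Fin k, W) →ₗ[ℝ] SymTensor k W :=
  LinearMap.codRestrict (symmetricTensors k W)
    ((Fintype.card (Equiv.Perm (Fin k)) : ℝ)⁻¹ •
      ∑ σ : Equiv.Perm (Fin k), (PiTensorProduct.reindex ℝ (fun _ : Fin k => W) σ).toLinearMap)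
    fun t σ => by
      simp only [LinearMap.smul_apply, LinearMap.sum_apply, LinearEquiv.coe_coe, map_smul, map_sum]
      congr 1
      refine Fintype.sum_equiv (Equiv.mulLeft σ) _ _ fun τ => ?_
      exact PiTensorProduct.reindex_reindex (s := fun _ => W) τ σ t

theorem SymTensor.toTensor_symmetrize (t : ⨂[ℝ] _ : Fin k, W) :
    SymTensor.toTensor k W (SymTensor.symmetrize k W t) =
      (Fintype.card (Equiv.Perm (Fin k)) : ℝ)⁻¹ •
        ∑ σ : Equiv.Perm (Fin k), PiTensorProduct.reindex ℝ (fun _ : Fin k => W) σ t := by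
  change ((Fintype.card (Equiv.Perm (Fin k)) : ℝ)⁻¹ •
      ∑ σ : Equiv.Perm (Fin k), (PiTensorProduct.reindex ℝ (fun _ : Fin k => W) σ).toLinearMap) t
    = _
  simp

theorem SymTensor.symmetrize_toTensor (t : SymTensor k W) :
    SymTensor.symmetrize k W (SymTensor.toTensor k W t) = t := by
  apply SymTensor.toTensor_injective
  have ht : ∀ σ : Equiv.Perm (Fin k), PiTensorProduct.reindex ℝ (fun _ : Fin k => W) σ
      (SymTensor.toTensor k W t) = SymTensor.toTensor k W t := t.2
  rw [SymTensor.toTensor_symmetrize]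
  simp only [ht, Finset.sum_const, Finset.card_univ]
  rw [← Nat.cast_smul_eq_nsmul ℝ, smul_smul, inv_mul_cancel₀, one_smul]
  exact Nat.cast_ne_zero.2 Fintype.card_ne_zero

theorem SymTensor.map_symmetrize {W' : Type} [AddCommGroup W'] [Module ℝ W'] (f : W →ₗ[ℝ] W')
    (t : ⨂[ℝ] _ : Fin k, W) :
    SymTensor.map k f (SymTensor.symmetrize k W t) =
      SymTensor.symmetrize k W' (PiTensorProduct.map (fun _ => f) t) := by
  apply SymTensor.toTensor_injective
  rw [SymTensor.toTensor_map, SymTensor.toTensor_symmetrize, SymTensor.toTensor_symmetrize,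
    map_smul, map_sum]
  congr 1
  exact Finset.sum_congr rfl fun σ _ =>
    PiTensorProduct.map_reindex (R := ℝ) (fun _ : Fin k => f) σ t

end Symmetrization

/-! ### Functoriality of constructions in linear maps -/

theorem tensorForm_map_left (k : ℕ) {W W' : Type} [NormedAddCommGroup W] [InnerProductSpace ℝ W]
    [NormedAddCommGroup W'] [InnerProductSpace ℝ W'] (f : W →ₗ[ℝ] W') (g : W' →ₗ[ℝ] W)
    (hfg : ∀ x y, inner ℝ (f x) y = inner ℝ x (g y)) (s : ⨂[ℝ] _ : Fin k, W)
    (t : ⨂[ℝ] _ : Fin k, W') :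
    tensorForm k W' (PiTensorProduct.map (fun _ => f) s) t =
      tensorForm k W s (PiTensorProduct.map (fun _ => g) t) := by
  induction s using PiTensorProduct.induction_on with
  | add x y hx hy => simp only [map_add, LinearMap.add_apply, hx, hy]
  | smul_tprod r v =>
    induction t using PiTensorProduct.induction_on with
    | add x y hx hy => simp only [map_add, hx, hy]
    | smul_tprod r' w =>
      simp only [map_smul, LinearMap.smul_apply, PiTensorProduct.map_tprod, tensorForm_tprod, hfg]

theorem inner_prodMapL2_left {E F E' F' : Type} [NormedAddCommGroup E] [InnerProductSpace ℝ E]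
    [NormedAddCommGroup F] [InnerProductSpace ℝ F] [NormedAddCommGroup E']
    [InnerProductSpace ℝ E'] [NormedAddCommGroup F'] [InnerProductSpace ℝ F']
    {f : E →ₗ[ℝ] E'} {f' : E' →ₗ[ℝ] E} {g : F →ₗ[ℝ] F'} {g' : F' →ₗ[ℝ] F}
    (hf : ∀ x y, inner ℝ (f x) y = inner ℝ x (f' y))
    (hg : ∀ x y, inner ℝ (g x) y = inner ℝ x (g' y))
    (x : WithLp 2 (E × F)) (y : WithLp 2 (E' × F')) :
    inner ℝ (prodMapL2 f g x) y = inner ℝ x (prodMapL2 f' g' y) := by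
  rw [WithLp.prod_inner_apply, WithLp.prod_inner_apply]
  exact congrArg₂ (· + ·) (hf x.fst y.fst) (hg x.snd y.snd)

namespace Construction

variable {C : NestedSymmetricGroups} (B : ConsistentSequence C)

/-- The action of a construction on linear maps: `F.map B f` is the linear map between the spaces
`F(B_m)` and `F(B_n)` induced by an arbitrary linear map `f : B_m → B_n`. The actions and the
embeddings of the sequence `F(B)`, and also the adjoints of the latter, are of this form. -/
noncomputable def map : (F : Construction) → {m n : ℕ} → (B.V m →ₗ[ℝ] B.V n) →
    ((F.apply B).V m →ₗ[ℝ] (F.apply B).V n)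
  | id, _, _, f => f
  | prod F G, _, _, f => prodMapL2 (F.map f) (G.map f)
  | tensor F G, _, _, f => TensorProduct.map (F.map f) (G.map f)
  | sym k F, _, _, f => SymTensor.map k (F.map f)

theorem map_comp (F : Construction) {l m n : ℕ} (f : B.V m →ₗ[ℝ] B.V n) (g : B.V l →ₗ[ℝ] B.V m) :
    F.map B (f ∘ₗ g) = F.map B f ∘ₗ F.map B g := by
  induction F with
  | id => rfl
  | prod F G hF hG => rw [map, hF, hG]; rfl
  | tensor F G hF hG => rw [map, hF, hG]; exact TensorProduct.map_comp _ _ _ _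
  | sym k F hF => rw [map, hF]; exact SymTensor.map_comp k _ _

theorem map_act (F : Construction) {n : ℕ} (g : Equiv.Perm (Fin n)) :
    F.map B (B.act n g) = (F.apply B).act n g := by
  induction F with
  | id => rfl
  | prod F G hF hG => rw [map, hF, hG]; rfl
  | tensor F G hF hG => rw [map, hF, hG]; rfl
  | sym k F hF => rw [map, hF]; rfl

theorem map_emb (F : Construction) {n N : C.Index} (h : n ≤ N) :
    F.map B (B.emb h) = (F.apply B).emb h := by
  induction F with
  | id => rfl
  | prod F G hF hG => rw [map, hF, hG]; rfl
  | tensor F G hF hG => rw [map, hF, hG]; rfl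
  | sym k F hF => rw [map, hF]; rfl

theorem adjoint_map (F : Construction) {m n : ℕ} (f : B.V m →ₗ[ℝ] B.V n) :
    LinearMap.adjoint (F.map B f) = F.map B (LinearMap.adjoint f) := by
  symm
  induction F with
  | id => rfl
  | prod F G hF hG =>
    refine (LinearMap.eq_adjoint_iff _ _).2 fun x y => ?_
    exact inner_prodMapL2_left ((LinearMap.eq_adjoint_iff _ _).1 hF)
      ((LinearMap.eq_adjoint_iff _ _).1 hG) x y
  | tensor F G hF hG =>
    rw [map, map, hF, hG]
    exact (TensorProduct.adjoint_map _ _).symm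
  | sym k F hF =>
    refine (LinearMap.eq_adjoint_iff _ _).2 fun x y => ?_
    exact tensorForm_map_left k _ _ ((LinearMap.eq_adjoint_iff _ _).1 hF) _ _

end Construction

/-! ### Sequences with a permuted basis -/

/-- Bases of the spaces of a consistent sequence `B` that are permuted by the symmetric groups in
the standard way. The adjoint of each embedding is required to send every basis vector to a basis
vector or to `0`, as recorded by the partial map `a`, and to hit every basis vector. -/
structure PermutedBasis {C : NestedSymmetricGroups} (B : ConsistentSequence C) where
  basis : ∀ n, Module.Basis (Fin n) ℝ (B.V n)
  act_basis : ∀ {n : ℕ} (g : Equiv.Perm (Fin n)) (i : Fin n), B.act n g (basis n i) = basis n (g i)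
  adjoint_emb_basis : ∀ {n N : C.Index} (h : n ≤ N),
    ∃ a : Fin (C.size N) → Option (Fin (C.size n)), (∀ i, ∃ j, a j = some i) ∧
      ∀ j, LinearMap.adjoint (B.emb h) (basis _ j) = (a j).elim 0 (basis _)

/-- The identity of a subset `S`, as a partial map. -/
def partialId {n : ℕ} (S : Finset (Fin n)) (i : Fin n) : Option (Fin n) :=
  if i ∈ S then some i else none

theorem partialId_of_mem {n : ℕ} {S : Finset (Fin n)} {i : Fin n} (hi : i ∈ S) :
    partialId S i = some i := if_pos hi

theorem partialId_bind {m n : ℕ} (S : Finset (Fin m)) (a : Fin m → Option (Fin n)) (i : Fin m) :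
    (partialId S i).bind a = if i ∈ S then a i else none := by
  unfold partialId
  split_ifs <;> rfl

theorem span_image2_tmul_eq_top {E E' : Type} [AddCommGroup E] [Module ℝ E] [AddCommGroup E']
    [Module ℝ E'] {s : Set E} {t : Set E'} (hs : Submodule.span ℝ s = ⊤)
    (ht : Submodule.span ℝ t = ⊤) :
    Submodule.span ℝ (Set.image2 (fun x y => x ⊗ₜ[ℝ] y) s t) = ⊤ := by
  have h := Submodule.map₂_span_span ℝ (TensorProduct.mk ℝ E E') s t
  rw [hs, ht, TensorProduct.map₂_mk_top_top_eq_top] at h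
  exact h.symm

namespace PermutedBasis

variable {C : NestedSymmetricGroups} {B : ConsistentSequence C} (e : PermutedBasis B)

/-- The linear map that sends basis vectors to basis vectors or to `0`, as prescribed by the
partial map `a`. -/
noncomputable def linMap {m n : ℕ} (a : Fin m → Option (Fin n)) : B.V m →ₗ[ℝ] B.V n :=
  (e.basis m).constr ℝ fun i => (a i).elim 0 (e.basis n)

theorem linMap_basis {m n : ℕ} (a : Fin m → Option (Fin n)) (i : Fin m) :
    e.linMap a (e.basis m i) = (a i).elim 0 (e.basis n) :=
  (e.basis m).constr_basis ℝ _ i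

theorem linMap_comp {l m n : ℕ} (b : Fin m → Option (Fin n)) (a : Fin l → Option (Fin m)) :
    e.linMap b ∘ₗ e.linMap a = e.linMap fun i => (a i).bind b := by
  refine (e.basis l).ext fun i => ?_
  rw [LinearMap.comp_apply, linMap_basis, linMap_basis]
  cases h : a i with
  | none => exact map_zero _
  | some j => exact e.linMap_basis b j

theorem linMap_perm {n : ℕ} (g : Equiv.Perm (Fin n)) :
    e.linMap (fun i => some (g i)) = B.act n g := by
  refine (e.basis n).ext fun i => ?_
  rw [linMap_basis, e.act_basis]
  rfl

theorem exists_adjoint_emb_eq_linMap {n N : C.Index} (h : n ≤ N) :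
    ∃ a : Fin (C.size N) → Option (Fin (C.size n)), (∀ i, ∃ j, a j = some i) ∧
      LinearMap.adjoint (B.emb h) = e.linMap a := by
  obtain ⟨a, ha, h'⟩ := e.adjoint_emb_basis h
  exact ⟨a, ha, (e.basis _).ext fun j => by rw [h', linMap_basis]⟩

/-- The map between the spaces of `F(B)` induced by a partial map of the index sets. -/
noncomputable def push (F : Construction) {m n : ℕ} (a : Fin m → Option (Fin n)) :
    (F.apply B).V m →ₗ[ℝ] (F.apply B).V n :=
  F.map B (e.linMap a)

variable (F : Construction)

theorem push_push {l m n : ℕ} (b : Fin m → Option (Fin n)) (a : Fin l → Option (Fin m))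
    (v : (F.apply B).V l) : e.push F b (e.push F a v) = e.push F (fun i => (a i).bind b) v := by
  rw [push, push, push, ← e.linMap_comp, F.map_comp]
  rfl

theorem push_perm {n : ℕ} (g : Equiv.Perm (Fin n)) :
    e.push F (fun i => some (g i)) = (F.apply B).act n g := by
  rw [push, linMap_perm, F.map_act]

/-- The vector `v` of `F(B)_n` only involves the coordinates in `S`: it is fixed by the map induced
by the coordinate projection onto `S`. -/
def SupportedIn {n : ℕ} (S : Finset (Fin n)) (v : (F.apply B).V n) : Prop :=
  e.push F (partialId S) v = v

variable {F} {e}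

theorem SupportedIn.push_congr {m n : ℕ} {S : Finset (Fin m)} {v : (F.apply B).V m}
    (hv : e.SupportedIn F S v) {a b : Fin m → Option (Fin n)} (hab : ∀ i ∈ S, a i = b i) :
    e.push F a v = e.push F b v := by
  rw [← show e.push F (partialId S) v = v from hv, push_push, push_push]
  congr 2
  funext i
  rw [partialId_bind, partialId_bind]
  split_ifs with hi
  · exact hab i hi
  · rfl

/-- Support is functorial: if `a` sends `S` into `S'` where it is defined, then it sends vectors
supported in `S` to vectors supported in `S'`. -/
theorem SupportedIn.push {m n : ℕ} {S : Finset (Fin m)} {v : (F.apply B).V m}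
    (hv : e.SupportedIn F S v) {a : Fin m → Option (Fin n)} {S' : Finset (Fin n)}
    (ha : ∀ i ∈ S, ∀ k, a i = some k → k ∈ S') : e.SupportedIn F S' (e.push F a v) := by
  unfold SupportedIn
  rw [push_push]
  refine hv.push_congr fun i hi => ?_
  cases h : a i with
  | none => rfl
  | some k => exact partialId_of_mem (ha i hi k h)

theorem SupportedIn.mono {n : ℕ} {S S' : Finset (Fin n)} (h : S ⊆ S') {v : (F.apply B).V n}
    (hv : e.SupportedIn F S v) : e.SupportedIn F S' v := by
  unfold SupportedIn
  conv_rhs => rw [← show e.push F (partialId S) v = v from hv]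
  exact hv.push_congr fun i hi => by rw [partialId_of_mem hi, partialId_of_mem (h hi)]

variable (e F)

/-- A sequence of degree `d` is spanned by vectors that involve at most `d` coordinates each. -/
theorem span_supportedIn_eq_top (n : ℕ) :
    Submodule.span ℝ {v : (F.apply B).V n | ∃ S : Finset (Fin n), S.card ≤ F.degree ∧
      e.SupportedIn F S v} = ⊤ := by
  induction F with
  | id =>
    refine top_unique ?_
    refine (e.basis n).span_eq.symm.trans_le (Submodule.span_mono ?_)
    rintro _ ⟨i, rfl⟩
    refine ⟨{i}, (Finset.card_singleton i).le, ?_⟩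
    change e.linMap (partialId {i}) (e.basis n i) = e.basis n i
    rw [linMap_basis, partialId_of_mem (Finset.mem_singleton_self i)]
    rfl
  | prod F G hF hG =>
    refine top_unique fun x _ => ?_
    let inlL : (F.apply B).V n →ₗ[ℝ] ((F.prod G).apply B).V n :=
      (WithLp.linearEquiv 2 ℝ ((F.apply B).V n × (G.apply B).V n)).symm.toLinearMap ∘ₗ
        LinearMap.inl ℝ _ _
    let inrL : (G.apply B).V n →ₗ[ℝ] ((F.prod G).apply B).V n :=
      (WithLp.linearEquiv 2 ℝ ((F.apply B).V n × (G.apply B).V n)).symm.toLinearMap ∘ₗ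
        LinearMap.inr ℝ _ _
    set U := Submodule.span ℝ {v : ((F.prod G).apply B).V n | ∃ S : Finset (Fin n),
      S.card ≤ (F.prod G).degree ∧ e.SupportedIn (F.prod G) S v}
    have h1 : (⊤ : Submodule ℝ ((F.apply B).V n)) ≤ U.comap inlL := by
      rw [← hF, Submodule.span_le]
      rintro v ⟨S, hS, hv⟩
      refine Submodule.subset_span ⟨S, hS.trans (le_max_left _ _), ?_⟩
      exact WithLp.ofLp_injective 2 (Prod.ext hv (map_zero (e.push G (partialId S))))
    have h2 : (⊤ : Submodule ℝ ((G.apply B).V n)) ≤ U.comap inrL := by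
      rw [← hG, Submodule.span_le]
      rintro v ⟨S, hS, hv⟩
      refine Submodule.subset_span ⟨S, hS.trans (le_max_right _ _), ?_⟩
      exact WithLp.ofLp_injective 2 (Prod.ext (map_zero (e.push F (partialId S))) hv)
    have hx : x = inlL (WithLp.fst x) + inrL (WithLp.snd x) :=
      WithLp.ofLp_injective 2 (Prod.ext (add_zero _).symm (zero_add _).symm)
    rw [hx]
    exact U.add_mem (h1 Submodule.mem_top) (h2 Submodule.mem_top)
  | tensor F G hF hG =>
    refine top_unique ((span_image2_tmul_eq_top hF hG).symm.trans_le (Submodule.span_mono ?_))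
    rintro _ ⟨v, ⟨S, hS, hv⟩, w, ⟨T, hT, hw⟩, rfl⟩
    refine ⟨S ∪ T, (Finset.card_union_le S T).trans (Nat.add_le_add hS hT), ?_⟩
    exact congrArg₂ (fun a b => a ⊗ₜ[ℝ] b) (hv.mono Finset.subset_union_left)
      (hw.mono Finset.subset_union_right)
  | sym k F hF =>
    set U := Submodule.span ℝ {v : ((F.sym k).apply B).V n | ∃ S : Finset (Fin n),
      S.card ≤ (F.sym k).degree ∧ e.SupportedIn (F.sym k) S v}
    -- Modulo `U`, the symmetrized tensors `v₁ ⋯ v_k` vanish when the `v_i` are in the spanning set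
    -- of `F(B)_n`, hence always.
    have key : (U.mkQ ∘ₗ SymTensor.symmetrize k ((F.apply B).V n)) = 0 := by
      refine PiTensorProduct.ext ?_
      refine MultilinearMap.ext_of_span_eq_top (γ := fun _ => {v : (F.apply B).V n //
        ∃ S : Finset (Fin n), S.card ≤ F.degree ∧ e.SupportedIn F S v})
        (g := fun _ => Subtype.val)
        (fun _ => (congrArg (Submodule.span ℝ) Subtype.range_val).trans hF) fun v => ?_
      refine (Submodule.Quotient.mk_eq_zero U).2 (Submodule.subset_span ?_)
      choose S hS hv using fun i => (v i).2
      refine ⟨Finset.univ.biUnion S, ?_, ?_⟩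
      · refine (Finset.card_biUnion_le_card_mul _ _ F.degree fun i _ => hS i).trans_eq ?_
        rw [Finset.card_univ, Fintype.card_fin]
        rfl
      · change SymTensor.map k (e.push F _) (SymTensor.symmetrize k _ _) = _
        rw [SymTensor.map_symmetrize, PiTensorProduct.map_tprod]
        congr 2
        funext i
        exact (hv i).mono (Finset.subset_biUnion_of_mem S (Finset.mem_univ i))
    refine top_unique fun t _ => ?_
    refine (Submodule.Quotient.mk_eq_zero U).1 ?_
    exact (congrArg U.mkQ (SymTensor.symmetrize_toTensor k _ t)).symm.trans
      (LinearMap.congr_fun key (SymTensor.toTensor k _ t))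

end PermutedBasis

/-! ### Limits of eventually constant systems -/

namespace ConsistentSequence

variable {C : NestedSymmetricGroups} (V : ConsistentSequence C)

theorem inner_symEmb {n N : C.Index} (h : n ≤ N) (v : V.invariants (C.size n))
    (w : V.invariants (C.size N)) : inner ℝ (V.symEmb h v) w = inner ℝ v (V.proj h w) := by
  have hw : ∀ g, V.act (C.size N) g (w : V.V (C.size N)) = w := w.2
  change inner ℝ (V.symEmb h v : V.V (C.size N)) (w : V.V (C.size N)) =
    inner ℝ (v : V.V (C.size n)) (V.proj h w : V.V (C.size n))
  rw [coe_symEmb, coe_proj, reynolds_apply, LinearMap.adjoint_inner_right, real_inner_smul_left,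
    sum_inner]
  have key : ∀ g, inner ℝ (V.act (C.size N) g (V.emb h v)) (w : V.V (C.size N)) =
      inner ℝ (V.emb h v) (w : V.V (C.size N)) := fun g => by
    conv_lhs => rw [← hw g]
    exact V.inner_act _ g _ _
  simp only [key, Finset.sum_const, Finset.card_univ, nsmul_eq_mul]
  rw [← mul_assoc, inv_mul_cancel₀ (Nat.cast_ne_zero.2 Fintype.card_ne_zero), one_mul]

/-- The symmetrized embedding is adjoint to the projection on invariants, hence injective as soon
as the projection is surjective. -/
theorem symEmb_injective_of_proj_surjective {n N : C.Index} (h : n ≤ N)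
    (hs : Function.Surjective (V.proj h)) : Function.Injective (V.symEmb h) := by
  refine (injective_iff_map_eq_zero _).2 fun v hv => ?_
  obtain ⟨w, hw⟩ := hs v
  have := V.inner_symEmb h v w
  rw [hv, hw, inner_zero_left] at this
  exact inner_self_eq_zero.1 this.symm

theorem proj_proj {n M N : C.Index} (h : n ≤ M) (h' : M ≤ N) (w : V.invariants (C.size N)) :
    V.proj h (V.proj h' w) = V.proj (h.trans h') w := by
  apply Subtype.ext
  rw [coe_proj, coe_proj, coe_proj, ← V.emb_trans h h', LinearMap.adjoint_comp]
  rfl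

/-- A point of an inverse limit over a directed set is determined by its component at any index
from which on all transition maps are bijective, and that component is arbitrary. -/
theorem piMap_bijective {n : C.Index}
    (hn : ∀ (M N : C.Index) (h : M ≤ N), n ≤ M → Function.Bijective (V.proj h)) :
    Function.Bijective (V.piMap n) := by
  constructor
  · refine (injective_iff_map_eq_zero _).2 fun v hv => ?_
    have hv0 : v.1 n = 0 := hv
    apply Subtype.ext
    funext m
    obtain ⟨N, hnN, hmN⟩ := exists_ge_ge n m
    have hN : v.1 N = 0 := by
      apply (hn n N hnN le_rfl).1
      rw [v.2 n N hnN, hv0, map_zero]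
    change v.1 m = 0
    rw [← v.2 m N hmN, hN, map_zero]
  · intro x
    choose N hnN hmN using fun m => exists_ge_ge n m
    choose y hy using fun m => (hn n (N m) (hnN m) le_rfl).2 x
    refine ⟨⟨fun m => V.proj (hmN m) (y m), fun m m' h => ?_⟩, ?_⟩
    · obtain ⟨M, hM, hM'⟩ := exists_ge_ge (N m) (N m')
      obtain ⟨z, hz⟩ := (hn n M ((hnN m).trans hM) le_rfl).2 x
      have e : V.proj hM z = y m := (hn n _ (hnN m) le_rfl).1 (by rw [proj_proj, hz, hy])
      have e' : V.proj hM' z = y m' := (hn n _ (hnN m') le_rfl).1 (by rw [proj_proj, hz, hy])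
      change V.proj h (V.proj (hmN m') (y m')) = V.proj (hmN m) (y m)
      rw [← e, ← e']
      simp only [proj_proj]
    · change V.proj (hmN n) (y n) = x
      exact hy n

theorem sigmaMap_bijective {n : C.Index}
    (hn : ∀ (M N : C.Index) (h : M ≤ N), n ≤ M → Function.Bijective (V.symEmb h)) :
    Function.Bijective (V.sigmaMap n) := by
  constructor
  · intro x y hxy
    obtain ⟨N, h, _, e⟩ := Quotient.exact hxy
    exact (hn n N h le_rfl).1 e
  · intro z
    induction z using Quotient.inductionOn with
    | h p =>
      obtain ⟨m, x⟩ := p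
      obtain ⟨N, hnN, hmN⟩ := exists_ge_ge n m
      obtain ⟨y, hy⟩ := (hn n N hnN le_rfl).2 (V.symEmb hmN x)
      exact ⟨y, Quotient.sound ⟨N, hnN, hmN, hy⟩⟩

/-- If from the index `k` on the invariants have constant dimension and the projections are
surjective, then all the transition maps and structure maps from `k` on are isomorphisms. -/
theorem bijective_of_proj_surjective_of_finrank_eq {k : C.Index}
    (hs : ∀ (n N : C.Index) (h : n ≤ N), k ≤ n → Function.Surjective (V.proj h))
    (hd : ∀ n : C.Index, k ≤ n → Module.finrank ℝ (V.invariants (C.size n)) =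
      Module.finrank ℝ (V.invariants (C.size k))) :
    (∀ n : C.Index, k ≤ n → Function.Bijective (V.piMap n) ∧ Function.Bijective (V.sigmaMap n)) ∧
      ∀ (n N : C.Index) (h : n ≤ N), k ≤ n →
        Function.Bijective (V.symEmb h) ∧ Function.Bijective (V.proj h) := by
  have key : ∀ (n N : C.Index) (h : n ≤ N), k ≤ n →
      Function.Bijective (V.symEmb h) ∧ Function.Bijective (V.proj h) := by
    intro n N h hk
    have e : Module.finrank ℝ (V.invariants (C.size n)) =
        Module.finrank ℝ (V.invariants (C.size N)) := (hd n hk).trans (hd N (hk.trans h)).symm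
    have hp := hs n N h hk
    have hi := V.symEmb_injective_of_proj_surjective h hp
    exact ⟨⟨hi, (LinearMap.injective_iff_surjective_of_finrank_eq_finrank e).1 hi⟩,
      (LinearMap.injective_iff_surjective_of_finrank_eq_finrank e.symm).2 hp, hp⟩
  exact ⟨fun n hk => ⟨V.piMap_bijective fun M N h hM => (key M N h (hk.trans hM)).2,
    V.sigmaMap_bijective fun M N h hM => (key M N h (hk.trans hM)).1⟩, key⟩

end ConsistentSequence

/-! ### Surjectivity on invariants -/

/-- The partial map `{0, …, N-1} → {0, …, n-1}` that is the identity where this makes sense. -/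
def partialRestrict (n N : ℕ) (i : Fin N) : Option (Fin n) :=
  if h : i.1 < n then some ⟨i.1, h⟩ else none

theorem exists_perm_extending {n : ℕ} {S : Finset (Fin n)} {c : Fin n → Fin n}
    (hc : Set.InjOn c S) : ∃ g : Equiv.Perm (Fin n), ∀ i ∈ S, c i = g i := by
  obtain ⟨g, hg⟩ := Finset.exists_equiv_extend_of_card_eq (t := Finset.univ)
    Finset.card_univ.symm (Finset.subset_univ (S.image c)) hc
  exact ⟨g.trans (Equiv.subtypeUnivEquiv Finset.mem_univ), fun i hi => (hg i hi).symm⟩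

/-- A partial map is on `S` either the restriction of a permutation, or its values on `S` are fewer
than the elements of `S`. -/
theorem exists_perm_or_card_lt {n : ℕ} (S : Finset (Fin n)) (c : Fin n → Option (Fin n)) :
    (∃ g : Equiv.Perm (Fin n), ∀ i ∈ S, c i = some (g i)) ∨
      ∃ S' : Finset (Fin n), S'.card < S.card ∧ ∀ i ∈ S, ∀ k, c i = some k → k ∈ S' := by
  by_cases h : none ∉ S.image c ∧ Set.InjOn c S
  · left
    have hs : ∀ i ∈ S, c i = some ((c i).getD i) := fun i hi => by
      cases h' : c i with
      | none => exact absurd (Finset.mem_image.2 ⟨i, hi, h'⟩) h.1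
      | some k => rfl
    obtain ⟨g, hg⟩ := exists_perm_extending (S := S) (c := fun i => (c i).getD i)
      fun i hi j hj hij => h.2 hi hj <| by
        rw [hs i hi, hs j hj]
        exact congrArg some hij
    exact ⟨g, fun i hi => (hs i hi).trans (congrArg some (hg i hi))⟩
  · right
    refine ⟨Finset.eraseNone (S.image c), ?_, fun i hi k hk =>
      Finset.mem_eraseNone.2 (Finset.mem_image.2 ⟨i, hi, hk⟩)⟩
    by_cases h0 : none ∈ S.image c
    · calc _ < (S.image c).card := by
            rw [Finset.card_eraseNone_eq_card_erase]
            exact Finset.card_erase_lt_of_mem h0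
        _ ≤ S.card := Finset.card_image_le
    · have hinj : ¬ Set.InjOn c S := fun h' => h ⟨h0, h'⟩
      calc _ ≤ (S.image c).card := by
            rw [Finset.card_eraseNone_eq_card_erase]
            exact Finset.card_erase_le
        _ < S.card := lt_of_le_of_ne Finset.card_image_le fun h' =>
            hinj (Finset.card_image_iff.1 h')

namespace ConsistentSequence

variable {C : NestedSymmetricGroups} (V : ConsistentSequence C)

/-- The map `V_n^{S_n} → V_N^{S_N}` that applies `f : V_n → V_N` and then averages over `S_N`. -/
noncomputable def symMap {n N : ℕ} (f : V.V n →ₗ[ℝ] V.V N) :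
    V.invariants n →ₗ[ℝ] V.invariants N :=
  LinearMap.codRestrict (V.invariants N) (V.reynolds N ∘ₗ f ∘ₗ (V.invariants n).subtype)
    fun _ => V.reynolds_mem _ _

theorem coe_symMap {n N : ℕ} (f : V.V n →ₗ[ℝ] V.V N) (v : V.invariants n) :
    (V.symMap f v : V.V N) = V.reynolds N (f v) := rfl

theorem sum_reynolds_act {n N : ℕ} (f : V.V n →ₗ[ℝ] V.V N) (x : V.V n) :
    ∑ g : Equiv.Perm (Fin n), V.reynolds N (f (V.act n g x)) =
      (Fintype.card (Equiv.Perm (Fin n)) : ℝ) • V.reynolds N (f (V.reynolds n x)) := by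
  rw [V.reynolds_apply n, map_smul, map_smul, smul_smul, mul_inv_cancel₀, one_smul, map_sum,
    map_sum]
  exact Nat.cast_ne_zero.2 Fintype.card_ne_zero

/-- To see that `symMap f` is surjective, it suffices to look at a spanning set of `V_N`, since the
averages of its elements span the invariants. -/
theorem symMap_surjective_of_span {n N : ℕ} (f : V.V n →ₗ[ℝ] V.V N) (s : Set (V.V N))
    (hs : Submodule.span ℝ s = ⊤)
    (h : ∀ v ∈ s, ∃ x : V.V n, V.reynolds N (f (V.reynolds n x)) = V.reynolds N v) :
    Function.Surjective (V.symMap f) := by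
  have key : (⊤ : Submodule ℝ (V.V N)) ≤
      (LinearMap.range (V.reynolds N ∘ₗ f ∘ₗ V.reynolds n)).comap (V.reynolds N) := by
    rw [← hs, Submodule.span_le]
    intro v hv
    obtain ⟨x, hx⟩ := h v hv
    exact ⟨x, hx⟩
  intro v
  obtain ⟨x, hx⟩ := key (Submodule.mem_top (x := (v : V.V N)))
  refine ⟨⟨V.reynolds n x, V.reynolds_mem n x⟩, Subtype.ext ?_⟩
  rw [coe_symMap]
  exact hx.trans (V.reynolds_of_mem N v.2)

end ConsistentSequence

namespace PermutedBasis

variable {C : NestedSymmetricGroups} {B : ConsistentSequence C} (e : PermutedBasis B)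
  (F : Construction)

/-- If the partial map `a` hits every index, then `x` can be found with image `v` up to averaging.
The induction is on the size of the support of `v`: lift `v` along a section of `a` and average
over `S_N`. Pushed forward by `a`, the terms of the average are either permuted copies of `v`, of
which there is at least one, or have smaller support. -/
theorem exists_reynolds_push_eq {n N : ℕ} {a : Fin N → Option (Fin n)}
    (ha : ∀ i, ∃ j, a j = some i) (S : Finset (Fin n)) (v : (F.apply B).V n)
    (hv : e.SupportedIn F S v) :
    ∃ x : (F.apply B).V N,
      (F.apply B).reynolds n (e.push F a ((F.apply B).reynolds N x)) =
        (F.apply B).reynolds n v := by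
  let R := LinearMap.range
    ((F.apply B).reynolds n ∘ₗ e.push F a ∘ₗ (F.apply B).reynolds N)
  change (F.apply B).reynolds n v ∈ R
  induction hs : S.card using Nat.strong_induction_on generalizing S v with
  | _ s ih =>
    choose j hj using ha
    let c : Equiv.Perm (Fin N) → Fin n → Option (Fin n) := fun g i => a (g (j i))
    have hterm : ∀ g, (F.apply B).reynolds n
        (e.push F a ((F.apply B).act N g (e.push F (fun i => some (j i)) v))) =
        (F.apply B).reynolds n (e.push F (c g) v) := fun g => by
      rw [← e.push_perm F g, push_push, push_push]
      rfl
    have hsum : ∑ g, (F.apply B).reynolds n (e.push F (c g) v) ∈ R := by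
      simp only [← hterm]
      rw [(F.apply B).sum_reynolds_act]
      exact R.smul_mem _ ⟨_, rfl⟩
    classical
    let good : Equiv.Perm (Fin N) → Prop := fun g =>
      ∃ h : Equiv.Perm (Fin n), ∀ i ∈ S, c g i = some (h i)
    have hgood : ∀ g, good g →
        (F.apply B).reynolds n (e.push F (c g) v) = (F.apply B).reynolds n v := by
      rintro g ⟨h, hh⟩
      rw [hv.push_congr hh, push_perm, (F.apply B).reynolds_act]
    have hbad : ∀ g, ¬ good g → (F.apply B).reynolds n (e.push F (c g) v) ∈ R := by
      intro g hg
      obtain ⟨S', hS', hc⟩ := (exists_perm_or_card_lt S (c g)).resolve_left hg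
      exact ih S'.card (hs ▸ hS') S' _ (hv.push hc) rfl
    have h1 : good 1 := ⟨1, fun i _ => hj i⟩
    rw [← Finset.sum_filter_add_sum_filter_not _ good] at hsum
    have hsum' := (R.add_mem_iff_left (R.sum_mem fun g hg =>
      hbad g (Finset.mem_filter.1 hg).2)).1 hsum
    rw [Finset.sum_congr rfl fun g hg => hgood g (Finset.mem_filter.1 hg).2, Finset.sum_const,
      ← Nat.cast_smul_eq_nsmul ℝ] at hsum'
    refine (R.smul_mem_iff (Nat.cast_ne_zero.2 ?_)).1 hsum'
    exact Finset.card_ne_zero.2 ⟨1, Finset.mem_filter.2 ⟨Finset.mem_univ _, h1⟩⟩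

theorem symMap_push_surjective {n N : ℕ} {a : Fin N → Option (Fin n)}
    (ha : ∀ i, ∃ j, a j = some i) :
    Function.Surjective ((F.apply B).symMap (e.push F a)) :=
  (F.apply B).symMap_surjective_of_span _ _ (e.span_supportedIn_eq_top F n)
    fun v ⟨S, _, hv⟩ => e.exists_reynolds_push_eq F ha S v hv

/-- The projections are surjective on invariants: they are induced by partial maps that hit every
index, and they preserve invariants, so that averaging has no effect on their values. -/
theorem proj_surjective (e : PermutedBasis B) {n N : C.Index} (h : n ≤ N) :
    Function.Surjective ((F.apply B).proj h) := by
  obtain ⟨a, ha, hadj⟩ := e.exists_adjoint_emb_eq_linMap h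
  intro v
  obtain ⟨w, hw⟩ := e.symMap_push_surjective F ha v
  refine ⟨w, Subtype.ext ?_⟩
  have hp : e.push F a = LinearMap.adjoint ((F.apply B).emb h) := by
    rw [push, ← hadj, ← F.adjoint_map, F.map_emb]
  have hw' := congrArg Subtype.val hw
  rw [ConsistentSequence.coe_symMap, hp,
    ConsistentSequence.reynolds_of_mem _ _ ((F.apply B).adjoint_emb_mem h w.2)] at hw'
  exact hw'

/-! ### Stability of the dimension -/

theorem finrank_invariants_le (e : PermutedBasis B) {n N : ℕ} (h : n ≤ N) :
    Module.finrank ℝ ((F.apply B).invariants n) ≤ Module.finrank ℝ ((F.apply B).invariants N) := by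
  refine LinearMap.finrank_le_finrank_of_surjective (f := (F.apply B).symMap (e.push F
    (partialRestrict n N))) ?_
  exact e.symMap_push_surjective F fun i => ⟨Fin.castLE h i, dif_pos i.2⟩

/-- From the degree on, the invariants do not grow: every element of `F(B)_N` is a sum of elements
with at most `n` coordinates, each of which is moved into the first `n` coordinates by a
permutation. -/
theorem symMap_push_castLE_surjective {n N : ℕ} (h : n ≤ N) (hd : F.degree ≤ n) :
    Function.Surjective ((F.apply B).symMap (e.push F fun i => some (Fin.castLE h i))) := by
  refine (F.apply B).symMap_surjective_of_span _ _ (e.span_supportedIn_eq_top F N) ?_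
  rintro v ⟨S, hS, hv⟩
  obtain ⟨g, hg⟩ : ∃ g : Equiv.Perm (Fin N), ∀ i ∈ S, (g i).1 < n := by
    have hcard : S.card ≤ (Finset.univ.map (Fin.castLEEmb h)).card := by
      rw [Finset.card_map, Finset.card_univ, Fintype.card_fin]
      exact hS.trans hd
    obtain ⟨T, hT, hTS⟩ := Finset.exists_subset_card_eq hcard
    let φ : S ≃ T := Finset.equivOfCardEq hTS.symm
    refine ⟨φ.extendSubtype, fun i hi => ?_⟩
    rw [φ.extendSubtype_apply_of_mem i hi]
    obtain ⟨k, -, hk⟩ := Finset.mem_map.1 (hT (φ ⟨i, hi⟩).2)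
    rw [← hk]
    exact k.2
  set f := e.push F fun i => some (Fin.castLE h i) with hf
  obtain ⟨u, hu⟩ : ∃ u, f u = (F.apply B).act N g v := by
    refine ⟨e.push F (fun i => partialRestrict n N (g i)) v, ?_⟩
    rw [hf, push_push, ← e.push_perm F g]
    refine hv.push_congr fun i hi => ?_
    unfold partialRestrict
    rw [dif_pos (hg i hi)]
    rfl
  -- `f` intertwines the two symmetric groups, so that averaging over `S_n` first is harmless.
  have hact : ∀ g' : Equiv.Perm (Fin n),
      f ((F.apply B).act n g' u) = (F.apply B).act N (blockIncl h g') (f u) := by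
    intro g'
    rw [← e.push_perm F g', ← e.push_perm F (blockIncl h g'), hf, push_push, push_push]
    congr 2
    funext i
    exact congrArg some (blockIncl_of_lt h g' (Fin.castLE h i) i.2).symm
  refine ⟨u, ?_⟩
  have hsum := (F.apply B).sum_reynolds_act f u
  simp only [hact, (F.apply B).reynolds_act, hu, Finset.sum_const, Finset.card_univ] at hsum
  rw [← Nat.cast_smul_eq_nsmul ℝ] at hsum
  exact (smul_right_injective _ (Nat.cast_ne_zero.2 Fintype.card_ne_zero) hsum).symm

theorem finrank_invariants_eq (e : PermutedBasis B) {n : ℕ} (h : F.degree ≤ n) :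
    Module.finrank ℝ ((F.apply B).invariants n) =
      Module.finrank ℝ ((F.apply B).invariants F.degree) :=
  le_antisymm (LinearMap.finrank_le_finrank_of_surjective
    (e.symMap_push_castLE_surjective F h le_rfl)) (e.finrank_invariants_le F h)

/-- All the limits and transition maps are controlled by any index `k` of size at least the degree.
The hypothesis `hC` makes the size of every later index at least the degree as well. -/
theorem limits_of_degree_le (e : PermutedBasis B) 
    (hC : ∀ {n N : C.Index}, n ≤ N → C.size n ≤ C.size N) {k : C.Index}
    (hk : F.degree ≤ C.size k) :
    Module.rank ℝ (F.apply B).freelyDescribed =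
        Module.rank ℝ ((F.apply B).invariants F.degree) ∧
      Module.rank ℝ (F.apply B).FreelySymmetrized =
        Module.rank ℝ ((F.apply B).invariants F.degree) ∧
      (∀ n : C.Index, k ≤ n →
        Function.Bijective ((F.apply B).piMap n) ∧ Function.Bijective ((F.apply B).sigmaMap n)) ∧
      ∀ (n N : C.Index) (h : n ≤ N), k ≤ n →
        Function.Bijective ((F.apply B).symEmb h) ∧ Function.Bijective ((F.apply B).proj h) := by
  have key := (F.apply B).bijective_of_proj_surjective_of_finrank_eq
    (fun n N h (_ : k ≤ n) => e.proj_surjective F h) fun n hn =>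
      (e.finrank_invariants_eq F (hk.trans (hC hn))).trans (e.finrank_invariants_eq F hk).symm
  have hrank : Module.rank ℝ ((F.apply B).invariants (C.size k)) =
      Module.rank ℝ ((F.apply B).invariants F.degree) := by
    rw [← Module.finrank_eq_rank, ← Module.finrank_eq_rank, e.finrank_invariants_eq F hk]
  have hk' := key.1 k le_rfl
  exact ⟨(LinearEquiv.ofBijective _ hk'.1).rank_eq.trans hrank,
    (LinearEquiv.ofBijective _ hk'.2).rank_eq.symm.trans hrank, key⟩

end PermutedBasis

/-! ### The two basic sequences have permuted bases -/

/-- The standard basis of `ℝⁿ`. -/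
noncomputable def euclideanBasis (n : ℕ) : Module.Basis (Fin n) ℝ (EuclideanSpace ℝ (Fin n)) :=
  (EuclideanSpace.basisFun (Fin n) ℝ).toBasis

theorem euclideanBasis_apply {n : ℕ} (i j : Fin n) :
    euclideanBasis n i j = if j = i then 1 else 0 := by
  simp [euclideanBasis]

theorem inner_euclideanBasis {n : ℕ} (x : EuclideanSpace ℝ (Fin n)) (i : Fin n) :
    inner ℝ (euclideanBasis n i) x = x i := by
  rw [euclideanBasis, OrthonormalBasis.coe_toBasis, EuclideanSpace.basisFun_inner]

theorem permAct_euclideanBasis {n : ℕ} (g : Equiv.Perm (Fin n)) (i : Fin n) :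
    permAct n g (euclideanBasis n i) = euclideanBasis n (g i) := by
  ext k
  simp only [permAct_apply, euclideanBasis_apply, Equiv.Perm.inv_eq_iff_eq]

theorem adjoint_euclideanBasis_apply {n N : ℕ}
    (f : EuclideanSpace ℝ (Fin n) →ₗ[ℝ] EuclideanSpace ℝ (Fin N)) (j : Fin N) (i : Fin n) :
    LinearMap.adjoint f (euclideanBasis N j) i = f (euclideanBasis n i) j := by
  rw [← inner_euclideanBasis, LinearMap.adjoint_inner_right, real_inner_comm,
    inner_euclideanBasis]

theorem adjoint_zeroPad_euclideanBasis (n N : ℕ) (j : Fin N) :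
    LinearMap.adjoint (zeroPad n N) (euclideanBasis N j) =
      (partialRestrict n N j).elim 0 (euclideanBasis n) := by
  ext i
  rw [adjoint_euclideanBasis_apply, zeroPad_apply]
  unfold partialRestrict
  split_ifs with h
  · simp only [Option.elim_some, euclideanBasis_apply, eq_comm]
  · rfl

theorem adjoint_duplicate_euclideanBasis {n N : ℕ} (hN : 0 < N) (h : n ∣ N) (j : Fin N) :
    LinearMap.adjoint (duplicate hN h) (euclideanBasis N j) =
      euclideanBasis n (blockOf hN h j) := by
  ext i
  simp only [adjoint_euclideanBasis_apply, duplicate_apply, euclideanBasis_apply, eq_comm]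

/-- The standard bases of the zero-padding sequence. -/
noncomputable def zeroPaddingBasis : PermutedBasis zeroPaddingSequence where
  basis := euclideanBasis
  act_basis := permAct_euclideanBasis
  adjoint_emb_basis {n N} h :=
    ⟨partialRestrict n N, fun i => ⟨Fin.castLE h i, dif_pos i.2⟩,
      adjoint_zeroPad_euclideanBasis n N⟩

/-- The standard bases of the duplication sequence. -/
noncomputable def duplicationBasis : PermutedBasis duplicationSequence where
  basis := euclideanBasis
  act_basis := permAct_euclideanBasis
  adjoint_emb_basis {_ N} h :=
    ⟨fun j => some (blockOf (DivIndex.pos N) h j),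
      fun i => (exists_blockOf_eq (DivIndex.pos N) h i).imp fun _ => congrArg some,
      adjoint_duplicate_euclideanBasis (DivIndex.pos N) h⟩

theorem mainTheorem7 (b : BasicSequence) (V : ConsistentSequence b.groups) (d : ℕ)
    (hV : V.HasDegreeOver b.sequence d) :
    Module.rank ℝ V.freelyDescribed = Module.rank ℝ (V.invariants d) ∧
    Module.rank ℝ V.FreelySymmetrized = Module.rank ℝ (V.invariants d) ∧
    ∃ k : b.groups.Index,
      (∀ n : b.groups.Index, k ≤ n →
        Function.Bijective (V.piMap n) ∧ Function.Bijective (V.sigmaMap n)) ∧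
      (∀ (n N : b.groups.Index) (h : n ≤ N), k ≤ n →
        Function.Bijective (V.symEmb h) ∧ Function.Bijective (V.proj h)) := by
  obtain ⟨F, rfl, rfl⟩ := hV
  cases b with
  | zeroPadding =>
    obtain ⟨h1, h2, h3⟩ := zeroPaddingBasis.limits_of_degree_le F (fun h => h)
      (k := F.degree) le_rfl
    exact ⟨h1, h2, _, h3⟩
  | duplication =>
    -- The index `0` is not available, so that `k = d + 1` is used to cover `d = 0` as well.
    obtain ⟨h1, h2, h3⟩ := duplicationBasis.limits_of_degree_le F
      (fun {n N} h => Nat.le_of_dvd (DivIndex.pos N) h)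
      (k := ⟨F.degree + 1, Nat.succ_pos _⟩) (Nat.le_succ _)
    exact ⟨h1, h2, _, h3⟩
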